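/- Let $f\colon\mathbb{C}\to\mathbb{C}$, $f(z)=e^z$, be the complex exponential map, and for $n\ge 1$ let $f^n$ denote its $n$-th iterate $f\circ\dots\circ f$ ($n$ times). Let $U\subset\mathbb{C}$ be open and nonempty. Then $U$ contains a repelling periodic point of $f$; that is, there exist a point $p\in U$ and an integer $n\ge 1$ such that $f^n(p)=p$ and $|(f^n)'(p)|>1$. -/

import Mathlib

/-!
An inverse branch of an iterate that contracts a closed disk into its interior has a fixed point
there, and this point is a repelling periodic point of the exponential. Such a branch is found for
a small disk `D` about any `d ≠ 0`.

The points which some iterate sends to the real line are dense. Otherwise all iterates `expⁿ` omit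
`ℝ` on some disk, so by the Schwarz lemma their derivatives with respect to the hyperbolic metric
`|dw| / |Im w|` on the image are bounded at its centre `z`. The step from `expⁿ` to `expⁿ⁺¹`
multiplies this derivative by `|y / sin y|`, where `y = Im (expⁿ z)`, so `Im (expⁿ z) → 0`. But
then `Re (expⁿ z) → ∞`, and from there on `|Im (expⁿ z)|` does not decrease, which is absurd.

So some `w ∈ D` reaches the real line and escapes to infinity along it. Since `exp` is its own
derivative, the branch of the inverse of `expⁿ` that takes `x = expⁿ w` back to `w` maps a disk of
radius `3` about `x` into `D` and contracts strongly. In the other direction, `log d + 2πik` can be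
chosen near `i eˣ`, and its logarithm lies near `x + iπ/2`: a branch of the inverse of `exp ∘ exp`
takes `D` into the disk of radius `3` about `x`. The composition of the two branches contracts `D`
into its interior.
-/

open Filter Function Metric Set
open scoped NNReal Topology

/-- A `K`-Lipschitz inverse branch of `f` on `S` with values in `T`. The branch `g` is total, but
only its restriction to `S` matters. -/
def HasInverseBranch {X Y : Type*} [PseudoEMetricSpace X] [PseudoEMetricSpace Y]
    (f : X → Y) (K : ℝ≥0) (S : Set Y) (T : Set X) : Prop :=
  ∃ g : Y → X, LipschitzOnWith K g S ∧ MapsTo g S T ∧ RightInvOn g f S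

namespace HasInverseBranch

section PseudoEMetricSpace

variable {X Y Z : Type*} [PseudoEMetricSpace X] [PseudoEMetricSpace Y] [PseudoEMetricSpace Z]

theorem mono {f : X → Y} {K K' : ℝ≥0} {S S' : Set Y} {T T' : Set X}
    (h : HasInverseBranch f K S T) (hK : K ≤ K') (hS : S' ⊆ S) (hT : T ⊆ T') :
    HasInverseBranch f K' S' T' :=
  let ⟨g, hlip, hmaps, hinv⟩ := h
  ⟨g, (hlip.mono hS).weaken hK, hmaps.mono hS hT, hinv.mono hS⟩

theorem comp {f : X → Y} {f' : Y → Z} {K K' : ℝ≥0} {S : Set Z} {T : Set Y} {V : Set X}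
    (hf' : HasInverseBranch f' K' S T) (hf : HasInverseBranch f K T V) :
    HasInverseBranch (f' ∘ f) (K * K') S V :=
  let ⟨g', hlip', hmaps', hinv'⟩ := hf'
  let ⟨g, hlip, hmaps, hinv⟩ := hf
  ⟨g ∘ g', hlip.comp hlip' hmaps', hmaps.comp hmaps', hinv.comp hinv' hmaps'⟩

protected theorem id (S : Set X) : HasInverseBranch id 1 S S :=
  ⟨id, LipschitzWith.id.lipschitzOnWith, mapsTo_id S, fun _ _ ↦ rfl⟩

end PseudoEMetricSpace

end HasInverseBranch

theorem one_le_mul_norm_deriv_of_rightInvOn {𝕜 : Type*} [NontriviallyNormedField 𝕜]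
    {f g : 𝕜 → 𝕜} {K : ℝ≥0} {S : Set 𝕜} {a : 𝕜} (hS : S ∈ 𝓝 a) (hlip : LipschitzOnWith K g S)
    (hinv : RightInvOn g f S) (hf : deriv f (g a) ≠ 0) : 1 ≤ K * ‖deriv f (g a)‖ := by
  have hg : HasDerivAt g (deriv f (g a))⁻¹ a :=
    (differentiableAt_of_deriv_ne_zero hf).hasDerivAt.of_local_left_inverse
      (hlip.continuousOn.continuousAt hS) hf (mem_of_superset hS hinv)
  have hle : ‖deriv f (g a)‖⁻¹ ≤ K := by
    simpa using hg.hasFDerivAt.le_of_lipschitzOn hS hlip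
  exact (inv_le_iff_one_le_mul₀ (norm_pos_iff.mpr hf)).mp hle

theorem HasInverseBranch.exists_isFixedPt_one_lt_norm_deriv {𝕜 : Type*}
    [NontriviallyNormedField 𝕜] {f : 𝕜 → 𝕜} {K : ℝ≥0} {S : Set 𝕜}
    (h : HasInverseBranch f K S (interior S)) (hK : K < 1) (hS : IsComplete S) (hne : S.Nonempty)
    (hf : ∀ z ∈ interior S, deriv f z ≠ 0) :
    ∃ p ∈ interior S, IsFixedPt f p ∧ 1 < ‖deriv f p‖ := by
  obtain ⟨g, hlip, hmaps, hinv⟩ := h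
  obtain ⟨x, hx⟩ := hne
  have hmaps' : MapsTo g S S := hmaps.mono_right interior_subset
  obtain ⟨p, hp, hgp : g p = p, -⟩ := ContractingWith.exists_fixedPoint' hS hmaps'
    ⟨hK, hlip.mapsToRestrict hmaps'⟩ hx (edist_ne_top _ _)
  have hp' : p ∈ interior S := hgp ▸ hmaps hp
  have hfp : f p = p := by simpa only [hgp] using hinv hp
  have hone : 1 ≤ K * ‖deriv f p‖ := by
    simpa only [hgp] using one_le_mul_norm_deriv_of_rightInvOn
      (mem_interior_iff_mem_nhds.mp hp') hlip hinv (hgp.symm ▸ hf p hp')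
  refine ⟨p, hp', hfp, ?_⟩
  by_contra! hle
  exact hone.not_gt (mul_lt_one_of_nonneg_of_lt_one_left K.2 hK hle)

theorem HasInverseBranch.exists_of_hasStrictFDerivAt {𝕜 E F : Type*} [NontriviallyNormedField 𝕜]
    [NormedAddCommGroup E] [NormedSpace 𝕜 E] [NormedAddCommGroup F] [NormedSpace 𝕜 F]
    [CompleteSpace E] {f : E → F} {f' : E ≃L[𝕜] F} {a : E} {U : Set E}
    (hf : HasStrictFDerivAt f (f' : E →L[𝕜] F) a) (hU : U ∈ 𝓝 a) :
    ∃ K : ℝ≥0, ∃ ρ > 0, HasInverseBranch f K (closedBall (f a) ρ) U := by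
  obtain ⟨K, S, hS, hlip⟩ := hf.to_localInverse.exists_lipschitzOnWith
  obtain ⟨ρ, hρ, hsub⟩ := nhds_basis_closedBall.mem_iff.mp
    (inter_mem (inter_mem hS (hf.localInverse_tendsto hU)) hf.eventually_right_inverse)
  exact ⟨K, ρ, hρ, hf.localInverse f f' a, hlip.mono fun y hy ↦ (hsub hy).1.1,
    fun y hy ↦ (hsub hy).1.2, fun y hy ↦ (hsub hy).2⟩

theorem deriv_iterate_ne_zero {𝕜 : Type*} [NontriviallyNormedField 𝕜] {f : 𝕜 → 𝕜}
    (hf : ∀ z, deriv f z ≠ 0) (n : ℕ) (z : 𝕜) : deriv f^[n] z ≠ 0 := by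
  induction n with
  | zero => simp
  | succ n ih =>
    rw [iterate_succ', deriv_comp z (differentiableAt_of_deriv_ne_zero (hf _))
      (differentiableAt_of_deriv_ne_zero ih)]
    exact mul_ne_zero (hf _) ih

theorem deriv_exp_iterate_ne_zero (n : ℕ) (z : ℂ) : deriv Complex.exp^[n] z ≠ 0 :=
  deriv_iterate_ne_zero (fun z ↦ by simp) n z

theorem exists_hasInverseBranch_exp_iterate (n : ℕ) {w : ℂ} {U : Set ℂ} (hU : U ∈ 𝓝 w) :
    ∃ K : ℝ≥0, ∃ ρ > 0,
      HasInverseBranch Complex.exp^[n] K (closedBall (Complex.exp^[n] w) ρ) U :=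
  have hstrict : HasStrictDerivAt Complex.exp^[n] (deriv Complex.exp^[n] w) w :=
    (Complex.differentiable_exp.iterate n).contDiff.contDiffAt.hasStrictDerivAt one_ne_zero
  HasInverseBranch.exists_of_hasStrictFDerivAt
    (hstrict.hasStrictFDerivAt_equiv (deriv_exp_iterate_ne_zero n w)) hU

theorem hasInverseBranch_exp {v : ℂ} {r : ℝ} {c : ℝ≥0} (hc : 0 < c)
    (hr : r + c ≤ ‖Complex.exp v‖) :
    HasInverseBranch Complex.exp c⁻¹ (closedBall (Complex.exp v) r) (closedBall v (r / c)) := by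
  have hc' : 0 < (c : ℝ) := hc
  have hw := Complex.exp_ne_zero v
  set w := Complex.exp v with hwdef
  have hc_le : ∀ z ∈ closedBall w r, (c : ℝ) ≤ ‖z‖ := fun z hz ↦ by
    linarith [norm_le_norm_add_norm_sub z w, mem_closedBall_iff_norm.mp hz, norm_sub_rev z w]
  have hne : ∀ z ∈ closedBall w r, z ≠ 0 := fun z hz ↦
    norm_pos_iff.mp (hc'.trans_le (hc_le z hz))
  have hslit : ∀ z ∈ closedBall w r, z / w ∈ Complex.slitPlane := fun z hz ↦ by
    have hlt : ‖z / w - 1‖ < 1 := by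
      rw [div_sub_one hw, norm_div, div_lt_one (norm_pos_iff.mpr hw)]
      linarith [mem_closedBall_iff_norm.mp hz]
    simpa using Complex.mem_slitPlane_of_norm_lt_one hlt
  have hderiv : ∀ z ∈ closedBall w r, HasDerivWithinAt (fun z ↦ v + Complex.log (z / w)) z⁻¹
      (closedBall w r) z := fun z hz ↦ by
    have := (((hasDerivAt_id' z).div_const w).clog (hslit z hz)).const_add v
    rw [div_div_div_cancel_right₀ hw, one_div] at this
    exact this.hasDerivWithinAt
  have hlip : LipschitzOnWith c⁻¹ (fun z ↦ v + Complex.log (z / w)) (closedBall w r) :=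
    (convex_closedBall w r).lipschitzOnWith_of_nnnorm_hasDerivWithin_le hderiv fun z hz ↦ by
      rw [nnnorm_inv]
      exact inv_anti₀ hc (hc_le z hz)
  refine ⟨_, hlip, fun z hz ↦ ?_, fun z hz ↦ ?_⟩
  · have hself : w ∈ closedBall w r := mem_closedBall_self (dist_nonneg.trans hz)
    calc dist (v + Complex.log (z / w)) v
        = dist (v + Complex.log (z / w)) (v + Complex.log (w / w)) := by simp [hw]
      _ ≤ c⁻¹ * dist z w := hlip.dist_le_mul z hz w hself
      _ ≤ c⁻¹ * r := by gcongr; exact hz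
      _ = r / c := inv_mul_eq_div _ _
  · change Complex.exp (v + Complex.log (z / w)) = z
    rw [Complex.exp_add, Complex.exp_log (div_ne_zero (hne z hz) hw), ← hwdef,
      mul_div_cancel₀ _ hw]

theorem hasInverseBranch_exp_iterate {r : ℝ} {c : ℝ≥0} (hr : 0 ≤ r) (hc : 1 ≤ c) (j : ℕ) (w : ℂ)
    (hw : ∀ i < j, r + c ≤ ‖Complex.exp^[i + 1] w‖) :
    HasInverseBranch Complex.exp^[j] (c ^ j)⁻¹ (closedBall (Complex.exp^[j] w) r)
      (closedBall w (r / c ^ j)) := by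
  induction j generalizing w with
  | zero => simpa using HasInverseBranch.id (closedBall w r)
  | succ j ih =>
    have hc' : (1 : ℝ) ≤ c := hc
    have hbranch := ih (Complex.exp w) fun i hi ↦ hw (i + 1) (by lia)
    have hlog := hasInverseBranch_exp (v := w) (r := r / c ^ j) (zero_lt_one.trans_le hc) <| by
      have : r / c ^ j ≤ r := div_le_self hr (one_le_pow₀ hc')
      linarith [show r + c ≤ ‖Complex.exp w‖ from hw 0 j.succ_pos]
    have := hbranch.comp hlog
    rwa [div_div, ← pow_succ, ← mul_inv_rev, ← pow_succ] at this

theorem eventually_hasInverseBranch_exp_iterate {w : ℂ} {U : Set ℂ} (hU : U ∈ 𝓝 w)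
    (hw : Tendsto (fun n ↦ ‖Complex.exp^[n] w‖) atTop atTop) {r : ℝ} (hr : 0 ≤ r) {K : ℝ≥0}
    (hK : 0 < K) :
    ∀ᶠ n in atTop, HasInverseBranch Complex.exp^[n] K (closedBall (Complex.exp^[n] w) r) U := by
  obtain ⟨M, hM⟩ := eventually_atTop.mp (hw.eventually_ge_atTop (r + (2 : ℝ≥0)))
  obtain ⟨C, ρ, hρ, hnear⟩ := exists_hasInverseBranch_exp_iterate M hU
  have hK' : 0 < (K : ℝ) := hK
  have hpow : Tendsto (fun j : ℕ ↦ (2 : ℝ) ^ j) atTop atTop :=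
    tendsto_pow_atTop_atTop_of_one_lt one_lt_two
  obtain ⟨J, hJ⟩ := eventually_atTop.mp
    ((hpow.eventually_ge_atTop (r / ρ)).and (hpow.eventually_ge_atTop (C / K)))
  filter_upwards [eventually_ge_atTop (J + M)] with n hn
  obtain ⟨j, rfl⟩ : ∃ j, n = j + M := Nat.exists_eq_add_of_le' (by lia)
  obtain ⟨hjρ, hjK⟩ := hJ j (by lia)
  have hfar := hasInverseBranch_exp_iterate hr one_le_two j (Complex.exp^[M] w) fun i _ ↦ by
    rw [← iterate_add_apply]
    exact hM _ (by lia)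
  rw [iterate_add_apply, iterate_add]
  refine (hfar.comp (hnear.mono le_rfl (closedBall_subset_closedBall ?_) subset_rfl)).mono
    ?_ subset_rfl subset_rfl
  · rw [NNReal.coe_ofNat]
    exact div_le_of_le_mul₀ (by positivity) hρ.le (by rwa [div_le_iff₀' hρ] at hjρ)
  · rw [← NNReal.coe_le_coe]
    push_cast
    rw [← div_eq_mul_inv]
    exact div_le_of_le_mul₀ (by positivity) hK'.le (by rwa [div_le_iff₀' hK'] at hjK)

theorem tendsto_atTop_of_eventually_add_le {u : ℕ → ℝ} {c : ℝ} (hc : 0 < c)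
    (hu : ∀ᶠ n in atTop, u n + c ≤ u (n + 1)) : Tendsto u atTop atTop := by
  obtain ⟨N, hN⟩ := eventually_atTop.mp hu
  have hlinear : ∀ n : ℕ, u N + n * c ≤ u (n + N) := fun n ↦ by
    induction n with
    | zero => simp
    | succ n ih =>
      have := hN (n + N) (by lia)
      rw [add_right_comm]
      push_cast
      linarith
  exact (tendsto_add_atTop_iff_nat N).mp <| tendsto_atTop_mono hlinear <|
    tendsto_atTop_add_const_left _ _ (tendsto_natCast_atTop_atTop.atTop_mul_const hc)

theorem tendsto_zero_of_mul_one_add_le {b t : ℕ → ℝ} (hb : BddAbove (range b)) (hb₀ : 0 < b 0)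
    (ht : ∀ n, 0 ≤ t n) (h : ∀ n, b n * (1 + t n) ≤ b (n + 1)) : Tendsto t atTop (𝓝 0) := by
  have hpos : ∀ n, 0 < b n := fun n ↦ by
    induction n with
    | zero => exact hb₀
    | succ n ih => exact (mul_pos ih (by linarith [ht n])).trans_le (h n)
  have hmono : Monotone b := monotone_nat_of_le_succ fun n ↦
    (le_mul_of_one_le_right (hpos n).le (by linarith [ht n])).trans (h n)
  have hlim := tendsto_atTop_ciSup hmono hb
  have hdiff : Tendsto (fun n ↦ (b (n + 1) - b n) / b 0) atTop (𝓝 0) := by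
    simpa using ((hlim.comp (tendsto_add_atTop_nat 1)).sub hlim).div_const (b 0)
  refine squeeze_zero ht (fun n ↦ (le_div_iff₀ hb₀).mpr ?_) hdiff
  linarith [h n, mul_le_mul_of_nonneg_left (hmono n.zero_le) (ht n)]

theorem sin_sq_mul_one_add_sq_div_four_le (y : ℝ) : Real.sin y ^ 2 * (1 + y ^ 2 / 4) ≤ y ^ 2 := by
  rcases le_total 2 |y| with hy | hy
  · have : 2 ^ 2 ≤ y ^ 2 := sq_le_sq.mpr (by simpa using hy)
    nlinarith [Real.sin_sq_le_one y]
  · have hcos : Real.cos (y / 2) ^ 2 * (1 + y ^ 2 / 4) ≤ 1 := by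
      obtain ⟨hy₁, hy₂⟩ := abs_le.mp hy
      have hpi := Real.pi_gt_three
      have hle := Real.cos_le_one_div_sqrt_sq_add_one (x := y / 2) (by linarith) (by linarith)
      have h0 := Real.cos_nonneg_of_mem_Icc (x := y / 2) ⟨by linarith, by linarith⟩
      have hsq := pow_le_pow_left₀ h0 hle 2
      rw [div_pow, one_pow, Real.sq_sqrt (by positivity), le_div_iff₀ (by positivity)] at hsq
      linarith
    have hsin : Real.sin (y / 2) ^ 2 ≤ (y / 2) ^ 2 := sq_le_sq.mpr Real.abs_sin_le_abs
    calc Real.sin y ^ 2 * (1 + y ^ 2 / 4)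
        = 4 * Real.sin (y / 2) ^ 2 * (Real.cos (y / 2) ^ 2 * (1 + y ^ 2 / 4)) := by
          rw [show y = 2 * (y / 2) by ring, Real.sin_two_mul]; ring_nf
      _ ≤ 4 * (y / 2) ^ 2 * 1 := by gcongr
      _ = y ^ 2 := by ring

theorem norm_deriv_le_of_im_pos {g : ℂ → ℂ} {z : ℂ} {δ : ℝ} (hδ : 0 < δ)
    (hg : DifferentiableOn ℂ g (ball z δ)) (him : ∀ x ∈ ball z δ, 0 < (g x).im) :
    ‖deriv g z‖ ≤ 2 * (g z).im / δ := by
  have hmaps : MapsTo (z + ·) (ball (0 : ℂ) δ) (ball z δ) := fun ζ hζ ↦ by simpa using hζ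
  set f : ℂ → ℂ := fun ζ ↦ Complex.I * (g (z + ζ) - g z) with hf
  have hfd : DifferentiableOn ℂ f (ball 0 δ) :=
    ((hg.comp (by fun_prop) hmaps).sub_const _).const_mul _
  have hre : MapsTo f (ball 0 δ) {w | w.re ≤ (g z).im} := fun ζ hζ ↦ by
    simpa [hf] using (him _ (hmaps hζ)).le
  have hbound : ∀ ζ ∈ ball (0 : ℂ) δ,
      ‖ζ⁻¹ • (g (z + ζ) - g z)‖ ≤ 2 * (g z).im / (δ - ‖ζ‖) := fun ζ hζ ↦ by
    have := Complex.borelCaratheodory_zero (him z (mem_ball_self hδ)) hfd hre hδ hζ (by simp [hf])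
    rcases eq_or_ne ζ 0 with rfl | hζ₀
    · simpa using div_nonneg (by linarith [him z (mem_ball_self hδ)]) hδ.le
    · rw [norm_smul, norm_inv, inv_mul_le_iff₀ (norm_pos_iff.mpr hζ₀)]
      simpa [hf, mul_comm, mul_left_comm, mul_div_assoc] using this
  have hslope := (hg.differentiableAt (ball_mem_nhds z hδ)).hasDerivAt.tendsto_slope_zero.norm
  have hlim : Tendsto (fun ζ : ℂ ↦ 2 * (g z).im / (δ - ‖ζ‖)) (𝓝[≠] 0) (𝓝 (2 * (g z).im / δ)) := by
    have : ContinuousAt (fun ζ : ℂ ↦ 2 * (g z).im / (δ - ‖ζ‖)) 0 :=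
      continuousAt_const.div (by fun_prop) (by simpa using hδ.ne')
    simpa [ContinuousAt] using this.tendsto.mono_left nhdsWithin_le_nhds
  exact le_of_tendsto_of_tendsto hslope hlim <|
    mem_nhdsWithin_of_mem_nhds (mem_of_superset (ball_mem_nhds 0 hδ) hbound)

theorem norm_deriv_le_of_im_ne_zero {g : ℂ → ℂ} {z : ℂ} {δ : ℝ} (hδ : 0 < δ)
    (hg : DifferentiableOn ℂ g (ball z δ)) (him : ∀ x ∈ ball z δ, (g x).im ≠ 0) :
    ‖deriv g z‖ ≤ 2 * |(g z).im| / δ := by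
  have hcont : ContinuousOn (fun x ↦ (g x).im) (ball z δ) :=
    Complex.continuous_im.comp_continuousOn hg.continuousOn
  wlog hz : 0 < (g z).im generalizing g
  · have hz' : (g z).im < 0 := (him z (mem_ball_self hδ)).lt_of_le (not_lt.mp hz)
    simpa [deriv.fun_neg] using this (g := fun x ↦ -g x) hg.neg (by simpa using him)
      hcont.neg (by simpa using hz')
  rw [abs_of_pos hz]
  refine norm_deriv_le_of_im_pos hδ hg fun x hx ↦ ?_
  by_contra! hle
  obtain ⟨y, hy, hy₀⟩ := (convex_ball z δ).isPreconnected.intermediate_value hx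
    (mem_ball_self hδ) hcont ⟨hle, hz.le⟩
  exact him y hy hy₀

/-- The norm of the derivative of `f` at `z` with respect to the Euclidean metric at `z` and the
hyperbolic metric `|dw| / |Im w|` of the upper and lower half-planes at `f z`. It has the junk
value `0` if `f z` is real. -/
noncomputable def halfPlaneNormDeriv (f : ℂ → ℂ) (z : ℂ) : ℝ :=
  ‖deriv f z‖ / |(f z).im|

theorem halfPlaneNormDeriv_le {f : ℂ → ℂ} {z : ℂ} {δ : ℝ} (hδ : 0 < δ)
    (hf : DifferentiableOn ℂ f (ball z δ)) (him : ∀ x ∈ ball z δ, (f x).im ≠ 0) :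
    halfPlaneNormDeriv f z ≤ 2 / δ := by
  rw [halfPlaneNormDeriv, div_le_iff₀ (abs_pos.mpr (him z (mem_ball_self hδ))),
    div_mul_eq_mul_div]
  exact norm_deriv_le_of_im_ne_zero hδ hf him

theorem halfPlaneNormDeriv_sq_mul_le {f : ℂ → ℂ} {z : ℂ} (hf : DifferentiableAt ℂ f z)
    (him : (Complex.exp (f z)).im ≠ 0) :
    halfPlaneNormDeriv f z ^ 2 * (1 + (f z).im ^ 2 / 4) ≤
      halfPlaneNormDeriv (Complex.exp ∘ f) z ^ 2 := by
  rw [Complex.exp_im] at him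
  have hsin : Real.sin (f z).im ≠ 0 := right_ne_zero_of_mul him
  have hy : (f z).im ≠ 0 := fun h ↦ hsin (by rw [h, Real.sin_zero])
  have hcomp : halfPlaneNormDeriv (Complex.exp ∘ f) z = ‖deriv f z‖ / |Real.sin (f z).im| := by
    rw [halfPlaneNormDeriv, comp_def, hf.hasDerivAt.cexp.deriv, norm_mul, Complex.norm_exp,
      Complex.exp_im, abs_mul, Real.abs_exp, mul_div_mul_left _ _ (Real.exp_pos _).ne']
  rw [hcomp, halfPlaneNormDeriv, div_pow, div_pow, sq_abs, sq_abs, div_mul_eq_mul_div,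
    div_le_div_iff₀ (by positivity) (by positivity), mul_assoc]
  gcongr
  linarith [sin_sq_mul_one_add_sq_div_four_le (f z).im]

theorem tendsto_im_exp_iterate {z : ℂ} {δ : ℝ} (hδ : 0 < δ)
    (him : ∀ n : ℕ, ∀ x ∈ ball z δ, (Complex.exp^[n] x).im ≠ 0) :
    Tendsto (fun n : ℕ ↦ (Complex.exp^[n] z).im) atTop (𝓝 0) := by
  have hdiff (n : ℕ) : Differentiable ℂ Complex.exp^[n] := Complex.differentiable_exp.iterate n
  have hz (n : ℕ) : (Complex.exp^[n] z).im ≠ 0 := him n z (mem_ball_self hδ)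
  have hbdd : BddAbove (range fun n : ℕ ↦ halfPlaneNormDeriv Complex.exp^[n] z ^ 2) := by
    refine ⟨(2 / δ) ^ 2, forall_mem_range.mpr fun n ↦ ?_⟩
    have : 0 ≤ halfPlaneNormDeriv Complex.exp^[n] z := by unfold halfPlaneNormDeriv; positivity
    gcongr
    exact halfPlaneNormDeriv_le hδ (hdiff n).differentiableOn (him n)
  have hpos : 0 < halfPlaneNormDeriv Complex.exp^[0] z ^ 2 := by
    have := hz 0
    simp only [halfPlaneNormDeriv, iterate_zero, deriv_id, norm_one, id] at this ⊢
    positivity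
  have hsq : Tendsto (fun n : ℕ ↦ (Complex.exp^[n] z).im ^ 2 / 4) atTop (𝓝 0) := by
    refine tendsto_zero_of_mul_one_add_le hbdd hpos (fun n ↦ by positivity) fun n ↦ ?_
    rw [iterate_succ' Complex.exp n]
    refine halfPlaneNormDeriv_sq_mul_le (hdiff n z) ?_
    simpa only [← iterate_succ_apply'] using hz (n + 1)
  have habs := (hsq.const_mul 4).sqrt
  simp only [mul_div_cancel₀ _ (four_ne_zero (α := ℝ)), Real.sqrt_sq_eq_abs, mul_zero,
    Real.sqrt_zero] at habs
  exact (tendsto_zero_iff_abs_tendsto_zero _).mpr habs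

theorem tendsto_re_exp_iterate_atTop {z : ℂ}
    (him : Tendsto (fun n : ℕ ↦ (Complex.exp^[n] z).im) atTop (𝓝 0)) :
    Tendsto (fun n : ℕ ↦ (Complex.exp^[n] z).re) atTop atTop := by
  have hcos : ∀ᶠ n : ℕ in atTop, Real.exp (-1 / 2) ≤ Real.cos (Complex.exp^[n] z).im := by
    have := (Real.continuous_cos.tendsto 0).comp him
    exact this.eventually_const_le (by rw [Real.cos_zero, Real.exp_lt_one_iff]; norm_num)
  refine tendsto_atTop_of_eventually_add_le one_half_pos (hcos.mono fun n hn ↦ ?_)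
  set x := (Complex.exp^[n] z).re
  calc x + 1 / 2 = (x + -1 / 2) + 1 := by ring
    _ ≤ Real.exp (x + -1 / 2) := Real.add_one_le_exp _
    _ = Real.exp x * Real.exp (-1 / 2) := Real.exp_add _ _
    _ ≤ Real.exp x * Real.cos (Complex.exp^[n] z).im := by gcongr
    _ = (Complex.exp^[n + 1] z).re := by rw [iterate_succ_apply', Complex.exp_re]

theorem exists_im_exp_iterate_eq_zero_of_tendsto {z : ℂ}
    (him : Tendsto (fun n : ℕ ↦ (Complex.exp^[n] z).im) atTop (𝓝 0)) :
    ∃ n : ℕ, (Complex.exp^[n] z).im = 0 := by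
  have hgrow : ∀ᶠ n : ℕ in atTop, |(Complex.exp^[n] z).im| ≤ |(Complex.exp^[n + 1] z).im| := by
    filter_upwards [(tendsto_re_exp_iterate_atTop him).eventually_ge_atTop (Real.pi / 2),
      him.abs.eventually_le_const (show |(0 : ℝ)| < Real.pi / 2 by simpa using Real.pi_pos)]
      with n hre hsmall
    set x := (Complex.exp^[n] z).re
    set y := (Complex.exp^[n] z).im
    calc |y| = Real.pi / 2 * (2 / Real.pi * |y|) := by field_simp
      _ ≤ Real.exp x * |Real.sin y| := by
        gcongr
        · linarith [Real.add_one_le_exp x]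
        · exact Real.mul_abs_le_abs_sin hsmall
      _ = |(Complex.exp^[n + 1] z).im| := by
        rw [iterate_succ_apply', Complex.exp_im, abs_mul, Real.abs_exp]
  obtain ⟨N, hN⟩ := eventually_atTop.mp hgrow
  have hmono : Monotone fun n : ℕ ↦ |(Complex.exp^[n + N] z).im| :=
    monotone_nat_of_le_succ fun n ↦ by simpa only [add_right_comm] using hN (n + N) (by lia)
  have hlim : Tendsto (fun n : ℕ ↦ |(Complex.exp^[n + N] z).im|) atTop (𝓝 0) := by
    simpa using (him.comp (tendsto_add_atTop_nat N)).abs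
  exact ⟨N, abs_nonpos_iff.mp (by simpa using hmono.ge_of_tendsto hlim 0)⟩

theorem dense_setOf_exists_im_exp_iterate_eq_zero :
    Dense {z : ℂ | ∃ n : ℕ, (Complex.exp^[n] z).im = 0} := by
  refine dense_iff.mpr fun z δ hδ ↦ ?_
  by_contra! hempty
  have him (n : ℕ) (x : ℂ) (hx : x ∈ ball z δ) : (Complex.exp^[n] x).im ≠ 0 := fun h ↦
    eq_empty_iff_forall_notMem.mp hempty x ⟨hx, n, h⟩
  obtain ⟨n, hn⟩ := exists_im_exp_iterate_eq_zero_of_tendsto (tendsto_im_exp_iterate hδ him)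
  exact him n z (mem_ball_self hδ) hn

theorem eventually_im_exp_iterate_eq_zero {z : ℂ} {N : ℕ} (hN : (Complex.exp^[N] z).im = 0) :
    ∀ᶠ n in atTop, (Complex.exp^[n] z).im = 0 := by
  filter_upwards [eventually_ge_atTop N] with n hn
  induction n, hn using Nat.le_induction with
  | base => exact hN
  | succ n _ ih => rw [iterate_succ_apply', Complex.exp_im, ih, Real.sin_zero, mul_zero]

theorem exists_exp_eq_norm_sub_le {d : ℂ} (hd : d ≠ 0) (y : ℝ) :
    ∃ a, Complex.exp a = d ∧ ‖a - y * Complex.I‖ ≤ ‖Complex.log d‖ + 2 * Real.pi := by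
  set θ := toIcoMod Real.two_pi_pos 0 y
  have hmod : y = θ + toIcoDiv Real.two_pi_pos 0 y * (2 * Real.pi) := by
    rw [← zsmul_eq_mul, toIcoMod_add_toIcoDiv_zsmul]
  have hmem : θ ∈ Ico 0 (2 * Real.pi) := by
    simpa using toIcoMod_mem_Ico Real.two_pi_pos 0 y
  refine ⟨Complex.log d + toIcoDiv Real.two_pi_pos 0 y * (2 * Real.pi * Complex.I), ?_, ?_⟩
  · rw [Complex.exp_add, Complex.exp_log hd, Complex.exp_int_mul_two_pi_mul_I, mul_one]
  · calc _ = ‖Complex.log d - θ * Complex.I‖ := by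
          congr 1; nth_rw 2 [hmod]; push_cast; ring
      _ ≤ ‖Complex.log d‖ + ‖θ * Complex.I‖ := norm_sub_le _ _
      _ ≤ _ := by
        gcongr; simpa [abs_of_nonneg hmem.1] using hmem.2.le

theorem eventually_exists_exp_exp_eq {d : ℂ} (hd : d ≠ 0) :
    ∀ᶠ x : ℝ in atTop, ∃ v : ℂ, Complex.exp (Complex.exp v) = d ∧ ‖v - x‖ ≤ 2 := by
  choose a ha_exp ha_norm using fun x : ℝ ↦ exists_exp_eq_norm_sub_le hd (Real.exp x)
  have hlim : Tendsto (fun x : ℝ ↦ a x / Real.exp x) atTop (𝓝 Complex.I) := by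
    refine tendsto_iff_norm_sub_tendsto_zero.mpr <|
      squeeze_zero (fun _ ↦ norm_nonneg _) (fun x ↦ ?_)
        (Real.tendsto_exp_atTop.const_div_atTop (‖Complex.log d‖ + 2 * Real.pi))
    have hexp : (Real.exp x : ℂ) ≠ 0 := Complex.ofReal_ne_zero.mpr (Real.exp_ne_zero x)
    rw [div_sub' hexp, norm_div, Complex.norm_real, Real.norm_eq_abs, Real.abs_exp]
    gcongr
    exact ha_norm x
  have hlog : Tendsto (fun x : ℝ ↦ Complex.log (a x / Real.exp x)) atTop
      (𝓝 (Complex.log Complex.I)) :=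
    hlim.clog (by simp [Complex.mem_slitPlane_iff])
  have hI : ‖Complex.log Complex.I‖ < 2 := by
    have hnorm : ‖Complex.log Complex.I‖ = Real.pi / 2 := by
      simp [Complex.log_I, abs_of_pos Real.pi_pos]
    linarith [Real.pi_lt_four]
  filter_upwards [hlim.eventually_ne Complex.I_ne_zero, hlog.norm.eventually_le_const hI]
    with x hne hle
  refine ⟨x + Complex.log (a x / Real.exp x), ?_, by simpa using hle⟩
  rw [Complex.exp_add, Complex.exp_log hne, Complex.ofReal_exp,
    mul_div_cancel₀ _ (Complex.exp_ne_zero _), ha_exp]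

theorem eventually_hasInverseBranch_exp_exp {d : ℂ} {δ : ℝ≥0} (hδ : 0 < δ) (hd : δ + δ ≤ ‖d‖) :
    ∀ᶠ x : ℝ in atTop,
      HasInverseBranch Complex.exp^[2] δ⁻¹ (closedBall d δ) (closedBall (x : ℂ) 3) := by
  have hδ' : 0 < (δ : ℝ) := hδ
  have hd₀ : d ≠ 0 := norm_pos_iff.mp (by linarith)
  filter_upwards [eventually_exists_exp_exp_eq hd₀, eventually_ge_atTop 3] with x ⟨v, hv, hvx⟩ hx
  have hexp : 1 + ((1 : ℝ≥0) : ℝ) ≤ ‖Complex.exp v‖ := by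
    have hre : x - v.re ≤ 2 :=
      calc x - v.re = (x - v : ℂ).re := by simp
        _ ≤ ‖(x - v : ℂ)‖ := Complex.re_le_norm _
        _ ≤ 2 := by rwa [norm_sub_rev]
    rw [Complex.norm_exp, NNReal.coe_one]
    linarith [Real.add_one_le_exp v.re]
  have houter :
      HasInverseBranch Complex.exp δ⁻¹ (closedBall d δ) (closedBall (Complex.exp v) 1) := by
    simpa [hv, hδ'.ne'] using hasInverseBranch_exp (v := Complex.exp v) (r := δ) hδ (by rwa [hv])
  have hinner : HasInverseBranch Complex.exp 1 (closedBall (Complex.exp v) 1) (closedBall v 1) := by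
    simpa using hasInverseBranch_exp zero_lt_one hexp
  have hsub : closedBall v 1 ⊆ closedBall (x : ℂ) 3 :=
    closedBall_subset_closedBall' (by rw [dist_eq_norm]; linarith)
  simpa using (houter.comp hinner).mono le_rfl subset_rfl hsub

theorem exists_isPeriodicPt_exp_mem_ball {d : ℂ} {δ : ℝ≥0} (hδ : 0 < δ) (hd : δ + δ ≤ ‖d‖) :
    ∃ p ∈ ball d δ, ∃ n : ℕ, 1 ≤ n ∧ IsPeriodicPt Complex.exp n p ∧
      1 < ‖deriv Complex.exp^[n] p‖ := by
  have hδ' : (δ : ℝ) ≠ 0 := (NNReal.coe_pos.mpr hδ).ne'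
  obtain ⟨w, hw, N, hN⟩ := dense_setOf_exists_im_exp_iterate_eq_zero.inter_open_nonempty
    (ball d δ) isOpen_ball (nonempty_ball.mpr hδ)
  have him := eventually_im_exp_iterate_eq_zero hN
  have hre := tendsto_re_exp_iterate_atTop <|
    tendsto_const_nhds.congr' (him.mono fun _ h ↦ h.symm)
  have hescape := tendsto_atTop_mono (fun n ↦ Complex.re_le_norm (Complex.exp^[n] w)) hre
  have hfar := eventually_hasInverseBranch_exp_iterate (isOpen_ball.mem_nhds hw) hescape
    zero_le_three (half_pos hδ)
  have hback := hre.eventually (eventually_hasInverseBranch_exp_exp hδ hd)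
  obtain ⟨n, himn, hfarn, hbackn⟩ := (him.and (hfar.and hback)).exists
  have hreal : ((Complex.exp^[n] w).re : ℂ) = Complex.exp^[n] w := Complex.ext rfl himn.symm
  rw [hreal] at hbackn
  have hbranch := hbackn.comp hfarn
  rw [← iterate_add, ← interior_closedBall d hδ'] at hbranch
  have hcontr : δ / 2 * δ⁻¹ < 1 := by
    rw [div_mul_eq_mul_div, mul_inv_cancel₀ hδ.ne']
    exact NNReal.half_lt_self one_ne_zero
  obtain ⟨p, hp, hfix, hrep⟩ := hbranch.exists_isFixedPt_one_lt_norm_deriv hcontr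
    isClosed_closedBall.isComplete ⟨d, mem_closedBall_self δ.2⟩
    fun z _ ↦ deriv_exp_iterate_ne_zero _ z
  exact ⟨p, interior_closedBall d hδ' ▸ hp, 2 + n, by lia, hfix, hrep⟩

theorem theorem5p7 (U : Set ℂ) (hU : IsOpen U) (hne : U.Nonempty) :
    ∃ p ∈ U, ∃ n : ℕ, 1 ≤ n ∧ Function.IsPeriodicPt Complex.exp n p ∧
      1 < ‖deriv (Complex.exp^[n]) p‖ := by
  obtain ⟨d, hdU, hd : d ≠ 0⟩ := (dense_compl_singleton (0 : ℂ)).inter_open_nonempty U hU hne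
  obtain ⟨ε, hε, hεU⟩ := Metric.isOpen_iff.mp hU d hdU
  have hpos : 0 < min ε (‖d‖ / 2) := lt_min hε (half_pos (norm_pos_iff.mpr hd))
  lift min ε (‖d‖ / 2) to ℝ≥0 using hpos.le with δ hδ
  obtain ⟨hδε, hδd⟩ := le_min_iff.mp hδ.le
  obtain ⟨p, hp, hrepelling⟩ :=
    exists_isPeriodicPt_exp_mem_ball (d := d) (NNReal.coe_pos.mp hpos) (by linarith)
  exact ⟨p, hεU (ball_subset_ball hδε hp), hrepelling⟩
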